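/- \textbf{Setting.} Consider the pure simply typed $\lambda$-calculus over one base type $o$: types are generated from $o$ by $\to$, terms are identified up to renaming of bound variables, and there are no constants. A \emph{theory} is a congruence on typed terms (compatible with application and $\lambda$-abstraction, closed under substitution) containing $\beta\eta$-conversion; it is \emph{consistent} if it does not contain every equation. For a type $i$ put $\mathsf K^{i}=\lambda x^{i}y^{i}.x$ and $\mathsf O^{i}=\lambda x^{i}y^{i}.y$. A \emph{quantitative applicative $\lambda$-algebra} $\mathcal A$ is a family of pseudometric spaces $(A_i,d_i)$, indexed by the types, with distances in $[0,\infty]$, with application maps $A_{i\to j}\times A_i\to A_j$ that are non-expansive for the maximum distance on the product, and with maps $\Lambda_{w,j}$ sending closed $\lambda$-terms of type $w\to j$ with parameters in $A$ to points of $A_{w\to j}$. Terms with parameters are interpreted in an environment by interpreting application as application, and $\lambda x.t$ as the value of $\Lambda$ at the closure $\lambda\vec y\,x.t$ applied to the values of the variables $\vec y$ of the context. Write $[\![t]\!]\colon A_w\to A_j$ for the function interpreting a term $t$ with parameters in the context $w$; these are the representable functions. $\mathcal A$ is a \emph{quantitative $\lambda$-algebra} if currying $[\![t]\!]\mapsto[\![\lambda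 x.t]\!]$ (from functions on $A_{w}\times A_i$ to $A_j$ to functions on $A_w$ to $A_{i\to j}$) is a section of evaluation, natural in $w$, and non-expansive for $$\Xi(f,g)=\inf\{\delta\mid \forall x,y\ \ d(f(x),g(y))\le\max\{\delta,d(x,y)\}\},$$ and it is \emph{extensional} if currying and evaluation are moreover mutually inverse (equalities of points being understood up to distance $0$). For pure closed terms $t,s$ of the same type write $d(t,s)$ for the distance of their interpretations. \textbf{Proposition.} The pure simply typed $\lambda$-calculus over $o$ has exactly one maximal consistent theory $\mathcal T$, and $\mathcal T$ does not equate $\mathsf K^o$ and $\mathsf O^o$. (1) Let $\mathcal A$ be a quantitative extensional $\lambda$-algebra, and let $\delta=d(\mathsf K^o,\mathsf O^o)\in[0,\infty]$. \begin{itemize} \item[(a)] Any two pure closed terms $t,s$ of the same type that are not equated in $\mathcal T$ satisfy $d(t,s)=\delta$; so all such pairs, of all types, are at the same distance. \item[(b)] Every $A_i$ is a pseudometric space bounded by $\delta$: $d_i(a,b)\le\delta$ for all $a,b\in A_i$. \item[(c)] If $\mathcal A$ satisfies all the equations of $\mathcal T$, then $\mathcal A$ is discrete on pure closed terms: for all such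 $t,s$ of the same type, $d(t,s)=0$ if $\mathcal T$ equates $t$ and $s$, and $d(t,s)=\delta$ otherwise. \item[(d)] If the underlying applicative structure of $\mathcal A$ is isomorphic to the full type structure over a two-element set ($A_o$ has two elements, $A_{i\to j}$ consists of all functions $A_i\to A_j$), then every $A_i$ is discrete: $d_i(a,b)=\delta$ for all $a\ne b$ in $A_i$. \end{itemize} (2) Let $\mathcal A$ be a quantitative $\lambda$-algebra, not necessarily extensional. Then every $A_i$ is bounded by $d(\mathsf K^i,\mathsf O^i)$, and $d(\mathsf K^o,\mathsf O^o)\le d(t,s)$ for all pure closed terms $t,s$ of the same type that are not equated in $\mathcal T$. -/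

import Mathlib

open scoped ENNReal

universe u v

namespace QLam

/-! ### Simple types and lambda-terms -/

/-- Simple types over a single base type `o`. -/
inductive Ty : Type
  | o : Ty
  | arr (i j : Ty) : Ty

/-- Typed variables in a context. Contexts are read from right to left: `i :: w` is the list `w`
extended at its end by a new, innermost variable of type `i` (written `w * i` on paper). -/
inductive Var : List Ty → Ty → Type
  | head {w : List Ty} {i : Ty} : Var (i :: w) i
  | tail {w : List Ty} {i j : Ty} (x : Var w i) : Var (j :: w) i

/-- Simply typed lambda-terms (up to renaming of bound variables) of type `j`, with free variables
in the context `w` and with constants from the family `C`. `Tm C []` are the closed terms. -/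
inductive Tm (C : Ty → Type u) : List Ty → Ty → Type u
  | var {w : List Ty} {j : Ty} (x : Var w j) : Tm C w j
  | cst {w : List Ty} {j : Ty} (c : C j) : Tm C w j
  | app {w : List Ty} {i j : Ty} (t : Tm C w (Ty.arr i j)) (s : Tm C w i) : Tm C w j
  | lam {w : List Ty} {i j : Ty} (t : Tm C (i :: w) j) : Tm C w (Ty.arr i j)

/-- Pure terms: no constants. -/
abbrev PTm : List Ty → Ty → Type := Tm (fun _ => Empty)

/-- Renamings. -/
abbrev Ren (w w' : List Ty) : Type := ∀ i : Ty, Var w i → Var w' i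

/-- Extension of a renaming under a binder. -/
def Ren.lift {w w' : List Ty} (r : Ren w w') (k : Ty) : Ren (k :: w) (k :: w')
  | _, Var.head => Var.head
  | _, Var.tail x => Var.tail (r _ x)

/-- Action of renamings on terms. -/
def Tm.rename {C : Ty → Type u} : {w : List Ty} → {j : Ty} → Tm C w j →
    {w' : List Ty} → Ren w w' → Tm C w' j
  | _, _, .var x, _, r => .var (r _ x)
  | _, _, .cst c, _, _ => .cst c
  | _, _, .app t s, _, r => .app (t.rename r) (s.rename r)
  | _, _, .lam t, _, r => .lam (t.rename (r.lift _))

/-- Weakening by one variable. -/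
def Tm.weaken {C : Ty → Type u} {w : List Ty} {j : Ty} (k : Ty) (t : Tm C w j) : Tm C (k :: w) j :=
  t.rename (fun _ x => Var.tail x)

/-- Simultaneous substitutions: a term in context `w'` for every variable of `w`. -/
abbrev Sub (C : Ty → Type u) (w w' : List Ty) : Type u := ∀ i : Ty, Var w i → Tm C w' i

/-- Extension of a substitution under a binder. -/
def Sub.lift {C : Ty → Type u} {w w' : List Ty} (σ : Sub C w w') (k : Ty) :
    Sub C (k :: w) (k :: w')
  | _, Var.head => .var Var.head
  | _, Var.tail x => (σ _ x).weaken k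

/-- Capture-avoiding substitution. -/
def Tm.subst {C : Ty → Type u} : {w : List Ty} → {j : Ty} → Tm C w j →
    {w' : List Ty} → Sub C w w' → Tm C w' j
  | _, _, .var x, _, σ => σ _ x
  | _, _, .cst c, _, _ => .cst c
  | _, _, .app t s, _, σ => .app (t.subst σ) (s.subst σ)
  | _, _, .lam t, _, σ => .lam (t.subst (σ.lift _))

/-- The substitution of `s` for the innermost variable. -/
def Sub.single {C : Ty → Type u} {w : List Ty} {k : Ty} (s : Tm C w k) : Sub C (k :: w) w
  | _, Var.head => s
  | _, Var.tail x => .var x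

/-- Replacement of constants. -/
def Tm.mapCst {C : Ty → Type u} {D : Ty → Type v} (f : ∀ i, C i → D i) :
    {w : List Ty} → {j : Ty} → Tm C w j → Tm D w j
  | _, _, .var x => .var x
  | _, _, .cst c => .cst (f _ c)
  | _, _, .app t s => .app (t.mapCst f) (s.mapCst f)
  | _, _, .lam t => .lam (t.mapCst f)

/-- The type `w → j`, that is `i₁ → ⋯ → iₙ → j` for the context `w = i₁ * ⋯ * iₙ`. -/
def arrs : List Ty → Ty → Ty
  | [], j => j
  | i :: w, j => arrs w (Ty.arr i j)

/-- The closure `λ x₁ ⋯ xₙ. t` of a term with respect to all the variables of its context. -/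
def Tm.close {C : Ty → Type u} : (w : List Ty) → {j : Ty} → Tm C w j → Tm C [] (arrs w j)
  | [], _, t => t
  | _ :: w, _, t => Tm.close w (.lam t)

/-- `K = λ x y. x` of type `i → i → i`. -/
def K (i : Ty) : PTm [] (Ty.arr i (Ty.arr i i)) := .lam (.lam (.var (Var.tail Var.head)))

/-- `O = λ x y. y` of type `i → i → i`. -/
def O (i : Ty) : PTm [] (Ty.arr i (Ty.arr i i)) := .lam (.lam (.var Var.head))

/-! ### Equational theories of the pure simply typed lambda-calculus -/

/-- (Extensional) lambda-theories of the pure simply typed lambda-calculus: congruences containing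
beta- and eta-conversion and closed under substitution. -/
@[ext]
structure LambdaTheory : Type where
  rel : ∀ {w : List Ty} {j : Ty}, PTm w j → PTm w j → Prop
  refl : ∀ {w : List Ty} {j : Ty} (t : PTm w j), rel t t
  symm : ∀ {w : List Ty} {j : Ty} {t s : PTm w j}, rel t s → rel s t
  trans : ∀ {w : List Ty} {j : Ty} {t s r : PTm w j}, rel t s → rel s r → rel t r
  app : ∀ {w : List Ty} {i j : Ty} {t t' : PTm w (Ty.arr i j)} {s s' : PTm w i},
    rel t t' → rel s s' → rel (Tm.app t s) (Tm.app t' s')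
  lam : ∀ {w : List Ty} {i j : Ty} {t s : PTm (i :: w) j},
    rel t s → rel (Tm.lam t) (Tm.lam s)
  beta : ∀ {w : List Ty} {i j : Ty} (t : PTm (i :: w) j) (s : PTm w i),
    rel (Tm.app (Tm.lam t) s) (t.subst (Sub.single s))
  eta : ∀ {w : List Ty} {i j : Ty} (t : PTm w (Ty.arr i j)),
    rel (Tm.lam (Tm.app (t.weaken i) (Tm.var Var.head))) t
  subst : ∀ {w w' : List Ty} {j : Ty} {t s : PTm w j} (σ : Sub (fun _ => Empty) w w'),
    rel t s → rel (t.subst σ) (s.subst σ)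

/-- Theories are ordered by inclusion. -/
instance : LE LambdaTheory :=
  ⟨fun T T' => ∀ (w : List Ty) (j : Ty) (t s : PTm w j), T.rel t s → T'.rel t s⟩

/-- A theory is consistent (non-trivial) if it does not prove every equation. -/
def LambdaTheory.Consistent (T : LambdaTheory) : Prop :=
  ∃ (w : List Ty) (j : Ty) (t s : PTm w j), ¬ T.rel t s

/-! ### Quantitative lambda-algebras -/

/-- Environments: the elements of the product `A_w`. -/
abbrev Env (A : Ty → Type u) (w : List Ty) : Type u := ∀ i : Ty, Var w i → A i

/-- The only element of the empty product. -/
def Env.nil (A : Ty → Type u) : Env A [] := fun _ x => nomatch x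

/-- Extension of an environment by a value of the innermost variable. -/
def Env.cons {A : Ty → Type u} {w : List Ty} {k : Ty} (ρ : Env A w) (a : A k) : Env A (k :: w)
  | _, Var.head => a
  | _, Var.tail x => ρ _ x

/-- Quantitative applicative lambda-algebras (for the pure signature): a family of pseudometric
spaces with distances in `[0, ∞]`, application maps, non-expansive for the max-distance on the
product, and closing maps `Lam`, sending each closed lambda-term of type `w → j` with parameters
in the algebra to a point of that type. -/
structure ApplicativeLambdaAlgebra : Type (u + 1) where
  carrier : Ty → Type u
  pseudoEMetric : ∀ i : Ty, PseudoEMetricSpace (carrier i)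
  app : ∀ {i j : Ty}, carrier (Ty.arr i j) → carrier i → carrier j
  app_nonexpansive : ∀ {i j : Ty} (f g : carrier (Ty.arr i j)) (a b : carrier i),
    edist (app f a) (app g b) ≤ max (edist f g) (edist a b)
  Lam : ∀ (w : List Ty) (j : Ty), Tm carrier [] (arrs w j) → carrier (arrs w j)

attribute [instance] ApplicativeLambdaAlgebra.pseudoEMetric

namespace ApplicativeLambdaAlgebra

variable (𝒜 : ApplicativeLambdaAlgebra.{u})

/-- Iterated application `f · a₁ · ⋯ · aₙ`. -/
def applyEnv : (w : List Ty) → {j : Ty} → 𝒜.carrier (arrs w j) → Env 𝒜.carrier w → 𝒜.carrier j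
  | [], _, f, _ => f
  | _ :: w, _, f, ρ => 𝒜.app (applyEnv w f (fun _ x => ρ _ (Var.tail x))) (ρ _ Var.head)

/-- The interpretation of terms with parameters. An abstraction is first closed with respect to the
variables of its context, then sent to a point by `Lam`, then applied to the values of these
variables. -/
def interp : {w : List Ty} → {j : Ty} → Tm 𝒜.carrier w j → Env 𝒜.carrier w → 𝒜.carrier j
  | _, _, .var x, ρ => ρ _ x
  | _, _, .cst a, _ => a
  | _, _, .app t s, ρ => 𝒜.app (interp t ρ) (interp s ρ)
  | w, _, @Tm.lam _ _ i j t, ρ => 𝒜.applyEnv w (𝒜.Lam (i :: w) j (Tm.close (i :: w) t)) ρ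

/-- The distance of the product `A_w`: the maximum of the distances of the components. -/
noncomputable def envDist {w : List Ty} (ρ ρ' : Env 𝒜.carrier w) : ℝ≥0∞ :=
  ⨆ (i : Ty) (x : Var w i), edist (ρ i x) (ρ' i x)

/-- The exponential pre-metric `Ξ` on functions from `A_w` to `A_j`. -/
noncomputable def Xi {w : List Ty} {j : Ty} (f g : Env 𝒜.carrier w → 𝒜.carrier j) : ℝ≥0∞ :=
  sInf {δ : ℝ≥0∞ | ∀ ρ ρ' : Env 𝒜.carrier w, edist (f ρ) (g ρ') ≤ max δ (𝒜.envDist ρ ρ')}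

/-- Quantitative lambda-algebras. The representable functions `A_w → A_j` are the functions
`𝒜.interp t`, for terms `t` with parameters. Currying takes the function of `t` in the context
`w * i` to the function of `λ x. t` in the context `w`, and evaluation takes `f` to
`(a, b) ↦ f a · b`. The conditions say that currying is a section of evaluation (`retraction`), is
natural in `w` (`natural`), and is non-expansive for `Ξ` (`curry_nonexpansive`); that evaluation is
natural and non-expansive holds by the non-expansiveness of application. Points at distance zero
are not distinguished. -/
structure IsLambdaAlgebra : Prop where
  retraction : ∀ {w : List Ty} {i j : Ty} (t : Tm 𝒜.carrier (i :: w) j)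
    (ρ : Env 𝒜.carrier w) (a : 𝒜.carrier i),
    edist (𝒜.app (𝒜.interp (Tm.lam t) ρ) a) (𝒜.interp t (ρ.cons a)) = 0
  natural : ∀ {w w' : List Ty} {i j : Ty} (t : Tm 𝒜.carrier (i :: w) j)
    (σ : Sub 𝒜.carrier w w') (ρ : Env 𝒜.carrier w'),
    edist (𝒜.interp (Tm.lam (t.subst (σ.lift i))) ρ)
      (𝒜.interp (Tm.lam t) (fun k x => 𝒜.interp (σ k x) ρ)) = 0
  curry_nonexpansive : ∀ {w : List Ty} {i j : Ty} (t s : Tm 𝒜.carrier (i :: w) j),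
    𝒜.Xi (𝒜.interp (Tm.lam t)) (𝒜.interp (Tm.lam s)) ≤ 𝒜.Xi (𝒜.interp t) (𝒜.interp s)

/-- Quantitative extensional lambda-algebras: currying is moreover inverse to evaluation. -/
structure IsExtensionalLambdaAlgebra : Prop extends 𝒜.IsLambdaAlgebra where
  section_eq : ∀ {w : List Ty} {i j : Ty} (t : Tm 𝒜.carrier w (Ty.arr i j))
    (ρ : Env 𝒜.carrier w),
    edist (𝒜.interp (Tm.lam (Tm.app (t.weaken i) (Tm.var Var.head))) ρ) (𝒜.interp t ρ) = 0

/-- The interpretation of pure terms. -/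
def pureInterp {w : List Ty} {j : Ty} (t : PTm w j) (ρ : Env 𝒜.carrier w) : 𝒜.carrier j :=
  𝒜.interp (t.mapCst (fun _ => Empty.elim)) ρ

/-- The distance between (the interpretations of) two pure closed terms. -/
noncomputable def termDist {j : Ty} (t s : PTm [] j) : ℝ≥0∞ :=
  edist (𝒜.pureInterp t (Env.nil _)) (𝒜.pureInterp s (Env.nil _))

/-- `𝒜` is a model of the theory `T`. -/
def Satisfies (T : LambdaTheory) : Prop :=
  ∀ (w : List Ty) (j : Ty) (t s : PTm w j), T.rel t s →
    ∀ ρ : Env 𝒜.carrier w, edist (𝒜.pureInterp t ρ) (𝒜.pureInterp s ρ) = 0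

end ApplicativeLambdaAlgebra

/-- The full type structure over a two-element set. -/
def FTS : Ty → Type
  | .o => Bool
  | .arr i j => FTS i → FTS j

/-- The applicative structure of `𝒜` is (up to isomorphism) the full type structure over a
two-element set. -/
def ApplicativeLambdaAlgebra.IsFullTypeStructure (𝒜 : ApplicativeLambdaAlgebra.{u}) : Prop :=
  ∃ e : ∀ i : Ty, 𝒜.carrier i ≃ FTS i,
    ∀ (i j : Ty) (f : 𝒜.carrier (Ty.arr i j)) (a : 𝒜.carrier i),
      e j (𝒜.app f a) = (show FTS i → FTS j from e (Ty.arr i j) f) (e i a)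

end QLam

open QLam

/-!
The greatest consistent theory `obsTheory` is the extensional collapse of the terms in two
variables `x y : o`. Call two such terms of type `o` observationally related if both are
beta-convertible to `x` or both to `y`, and extend this to all types as a binary logical relation
`Obs`. The fundamental lemma `Obs.subst` says that every term preserves `Obs`. In particular every
term of type `o` over `x y` is beta-convertible to one of the two variables, so no normalization
theorem is needed. The relation is a partial equivalence relation, because `x` and `y` are not
convertible (they are distinguished by the full type structure over `Bool`); hence "sends related
substitutions to related terms" is a theory, consistent because `K x y` and `O x y` are not
related. It contains any consistent theory `T`: two `T`-equal terms over `x y`, applied to related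
arguments down to type `o`, become `T`-equal variables, which have to coincide, since
`x = y` makes `T` inconsistent (`LambdaTheory.not_consistent_of_rel`).

Only beta-conversion enters the definition of `Obs` (eta holds in `obsTheory` since `Obs` is
extensional), so it applies to algebras that are not extensional, where beta-conversion is sound
(`Beta.edist_pureInterp`). If `a` and `b` over `x y` are not related, applying both to suitable
arguments turns them into the two different variables. Terms with parameters denote non-expansive
functions, so this application does not increase `Ξ`; currying twice does not either, whence
`d(K, O) ≤ Ξ(⟦a⟧, ⟦b⟧)` (`termDist_K_O_le_Xi`). Conversely `a = K a b` and `b = O a b` bound all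
distances of `A_i` by `d(Kⁱ, Oⁱ)`, and in the extensional case the bound at the base type is
inherited by all function types, a point being the currying of its own evaluation.
-/

namespace QLam

/-! ### Calculus of substitutions -/

section Substitution

variable {C : Ty → Type u} {D : Ty → Type v}

/-- Extension of a substitution by a term for the innermost variable. -/
def Sub.cons {w w' : List Ty} {k : Ty} (σ : Sub C w w') (a : Tm C w' k) : Sub C (k :: w) w'
  | _, Var.head => a
  | _, Var.tail x => σ _ x

/-- Composition of substitutions, in diagrammatic order. -/
def Sub.comp {w w' w'' : List Ty} (σ : Sub C w w') (τ : Sub C w' w'') : Sub C w w'' :=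
  fun i x => (σ i x).subst τ

theorem Ren.lift_comp {w w' w'' : List Ty} (r : Ren w w') (r' : Ren w' w'') (k : Ty) :
    (fun i x => r'.lift k i (r.lift k i x)) = Ren.lift (fun i x => r' i (r i x)) k := by
  funext i x
  cases x <;> rfl

theorem Tm.rename_rename {w : List Ty} {j : Ty} (t : Tm C w j) {w' w'' : List Ty}
    (r : Ren w w') (r' : Ren w' w'') :
    (t.rename r).rename r' = t.rename (fun i x => r' i (r i x)) := by
  induction t generalizing w' w'' with
  | var x => rfl
  | cst c => rfl
  | app t s iht ihs => simp only [Tm.rename, iht, ihs]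
  | lam t ih => simp only [Tm.rename, ih, Ren.lift_comp]

theorem Sub.lift_ren {w w' w'' : List Ty} (r : Ren w w') (σ : Sub C w' w'') (k : Ty) :
    (fun i x => σ.lift k i (r.lift k i x)) = Sub.lift (fun i x => σ i (r i x)) k := by
  funext i x
  cases x <;> rfl

theorem Tm.subst_rename {w : List Ty} {j : Ty} (t : Tm C w j) {w' w'' : List Ty}
    (r : Ren w w') (σ : Sub C w' w'') :
    (t.rename r).subst σ = t.subst (fun i x => σ i (r i x)) := by
  induction t generalizing w' w'' with
  | var x => rfl
  | cst c => rfl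
  | app t s iht ihs => simp only [Tm.rename, Tm.subst, iht, ihs]
  | lam t ih => simp only [Tm.rename, Tm.subst, ih, Sub.lift_ren]

theorem Sub.lift_rename {w w' w'' : List Ty} (σ : Sub C w w') (r : Ren w' w'') (k : Ty) :
    (fun i x => (σ.lift k i x).rename (r.lift k)) =
      Sub.lift (fun i x => (σ i x).rename r) k := by
  funext i x
  cases x with
  | head => rfl
  | tail x =>
    simp only [Sub.lift, Tm.weaken, Tm.rename_rename]
    rfl

theorem Tm.rename_subst {w : List Ty} {j : Ty} (t : Tm C w j) {w' w'' : List Ty}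
    (σ : Sub C w w') (r : Ren w' w'') :
    (t.subst σ).rename r = t.subst (fun i x => (σ i x).rename r) := by
  induction t generalizing w' w'' with
  | var x => rfl
  | cst c => rfl
  | app t s iht ihs => simp only [Tm.rename, Tm.subst, iht, ihs]
  | lam t ih => simp only [Tm.rename, Tm.subst, ih, Sub.lift_rename]

theorem Sub.lift_comp_lift {w w' w'' : List Ty} (σ : Sub C w w') (τ : Sub C w' w'') (k : Ty) :
    (σ.lift k).comp (τ.lift k) = (σ.comp τ).lift k := by
  funext i x
  cases x with
  | head => rfl
  | tail x =>
    simp only [Sub.comp, Sub.lift, Tm.weaken, Tm.subst_rename, Tm.rename_subst]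

theorem Tm.subst_subst {w : List Ty} {j : Ty} (t : Tm C w j) {w' w'' : List Ty}
    (σ : Sub C w w') (τ : Sub C w' w'') :
    (t.subst σ).subst τ = t.subst (σ.comp τ) := by
  induction t generalizing w' w'' with
  | var x => rfl
  | cst c => rfl
  | app t s iht ihs => simp only [Tm.subst, iht, ihs]
  | lam t ih => simp only [Tm.subst, ih, Sub.lift_comp_lift]

theorem Sub.lift_var {w : List Ty} (k : Ty) :
    Sub.lift (fun _ x => Tm.var x : Sub C w w) k = fun _ x => Tm.var x := by
  funext i x
  cases x <;> rfl

theorem Tm.subst_var {w : List Ty} {j : Ty} (t : Tm C w j) :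
    t.subst (fun _ x => Tm.var x) = t := by
  induction t with
  | var x => rfl
  | cst c => rfl
  | app t s iht ihs => simp only [Tm.subst, iht, ihs]
  | lam t ih => simp only [Tm.subst, Sub.lift_var, ih]

theorem Tm.subst_weaken {w w' : List Ty} {j k : Ty} (t : Tm C w j) (σ : Sub C (k :: w) w') :
    (t.weaken k).subst σ = t.subst (fun i x => σ i (Var.tail x)) :=
  t.subst_rename _ _

theorem Tm.subst_weaken_single {w : List Ty} {j k : Ty} (t : Tm C w j) (a : Tm C w k) :
    (t.weaken k).subst (Sub.single a) = t :=
  (t.subst_weaken _).trans t.subst_var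

theorem Tm.subst_lift_single {w w' : List Ty} {j k : Ty} (t : Tm C (k :: w) j)
    (σ : Sub C w w') (a : Tm C w' k) :
    (t.subst (σ.lift k)).subst (Sub.single a) = t.subst (σ.cons a) := by
  rw [Tm.subst_subst]
  congr 1
  funext i x
  cases x with
  | head => rfl
  | tail x => exact Tm.subst_weaken_single _ _

theorem Sub.single_comp {w w' : List Ty} {k : Ty} (s : Tm C w k) (σ : Sub C w w') :
    (Sub.single s).comp σ = σ.cons (s.subst σ) := by
  funext i x
  cases x <;> rfl

theorem Tm.mapCst_rename (f : ∀ i, C i → D i) {w : List Ty} {j : Ty} (t : Tm C w j)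
    {w' : List Ty} (r : Ren w w') : (t.rename r).mapCst f = (t.mapCst f).rename r := by
  induction t generalizing w' with
  | var x => rfl
  | cst c => rfl
  | app t s iht ihs => simp only [Tm.rename, Tm.mapCst, iht, ihs]
  | lam t ih => simp only [Tm.rename, Tm.mapCst, ih]

theorem Sub.mapCst_lift (f : ∀ i, C i → D i) {w w' : List Ty} (σ : Sub C w w') (k : Ty) :
    (fun i x => (σ.lift k i x).mapCst f) = Sub.lift (fun i x => (σ i x).mapCst f) k := by
  funext i x
  cases x with
  | head => rfl
  | tail x => exact Tm.mapCst_rename _ _ _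

theorem Tm.mapCst_subst (f : ∀ i, C i → D i) {w : List Ty} {j : Ty} (t : Tm C w j)
    {w' : List Ty} (σ : Sub C w w') :
    (t.subst σ).mapCst f = (t.mapCst f).subst (fun i x => (σ i x).mapCst f) := by
  induction t generalizing w' with
  | var x => rfl
  | cst c => rfl
  | app t s iht ihs => simp only [Tm.subst, Tm.mapCst, iht, ihs]
  | lam t ih => simp only [Tm.subst, Tm.mapCst, ih, Sub.mapCst_lift]

end Substitution

/-! ### Beta-conversion and the full type structure -/

/-- Beta-conversion of pure terms, without eta. -/
inductive Beta : ∀ {w : List Ty} {j : Ty}, PTm w j → PTm w j → Prop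
  | refl {w : List Ty} {j : Ty} (t : PTm w j) : Beta t t
  | symm {w : List Ty} {j : Ty} {t s : PTm w j} : Beta t s → Beta s t
  | trans {w : List Ty} {j : Ty} {t s r : PTm w j} : Beta t s → Beta s r → Beta t r
  | app {w : List Ty} {i j : Ty} {t t' : PTm w (Ty.arr i j)} {s s' : PTm w i} :
      Beta t t' → Beta s s' → Beta (Tm.app t s) (Tm.app t' s')
  | lam {w : List Ty} {i j : Ty} {t s : PTm (i :: w) j} :
      Beta t s → Beta (Tm.lam t) (Tm.lam s)
  | beta {w : List Ty} {i j : Ty} (t : PTm (i :: w) j) (s : PTm w i) :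
      Beta (Tm.app (Tm.lam t) s) (t.subst (Sub.single s))

theorem Beta.rel {w : List Ty} {j : Ty} {t s : PTm w j} (h : Beta t s) (T : LambdaTheory) :
    T.rel t s := by
  induction h with
  | refl t => exact T.refl t
  | symm _ ih => exact T.symm ih
  | trans _ _ ih ih' => exact T.trans ih ih'
  | app _ _ ih ih' => exact T.app ih ih'
  | lam _ ih => exact T.lam ih
  | beta t s => exact T.beta t s

theorem Beta.app_lam_subst {w w' : List Ty} {i j : Ty} (t : PTm (i :: w) j)
    (σ : Sub (fun _ => Empty) w w') (a : PTm w' i) :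
    Beta (Tm.app ((Tm.lam t).subst σ) a) (t.subst (σ.cons a)) := by
  rw [← Tm.subst_lift_single]
  exact Beta.beta _ _

/-- The interpretation of pure terms in the full type structure over `Bool`. -/
def eval : {w : List Ty} → {j : Ty} → PTm w j → Env FTS w → FTS j
  | _, _, .var x, ρ => ρ _ x
  | _, _, .app t s, ρ => eval t ρ (eval s ρ)
  | _, _, .lam t, ρ => fun a => eval t (ρ.cons a)

theorem eval_rename {w : List Ty} {j : Ty} (t : PTm w j) {w' : List Ty} (r : Ren w w')
    (ρ : Env FTS w') : eval (t.rename r) ρ = eval t (fun i x => ρ i (r i x)) := by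
  induction t generalizing w' with
  | var x => rfl
  | cst c => exact c.elim
  | app t s iht ihs => simp only [Tm.rename, eval, iht, ihs]
  | lam t ih =>
    funext a
    simp only [Tm.rename, eval, ih]
    congr 1
    funext i x
    cases x <;> rfl

theorem eval_subst {w : List Ty} {j : Ty} (t : PTm w j) {w' : List Ty}
    (σ : Sub (fun _ => Empty) w w') (ρ : Env FTS w') :
    eval (t.subst σ) ρ = eval t (fun i x => eval (σ i x) ρ) := by
  induction t generalizing w' with
  | var x => rfl
  | cst c => exact c.elim
  | app t s iht ihs => simp only [Tm.subst, eval, iht, ihs]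
  | lam t ih =>
    funext a
    simp only [Tm.subst, eval, ih]
    congr 1
    funext i x
    cases x with
    | head => rfl
    | tail x => exact eval_rename _ _ _

theorem Beta.eval_eq {w : List Ty} {j : Ty} {t s : PTm w j} (h : Beta t s) (ρ : Env FTS w) :
    eval t ρ = eval s ρ := by
  induction h with
  | refl t => rfl
  | symm _ ih => exact (ih ρ).symm
  | trans _ _ ih ih' => exact (ih ρ).trans (ih' ρ)
  | app _ _ ih ih' => simp only [eval, ih, ih']
  | lam _ ih =>
    funext a
    exact ih _
  | beta t s =>
    rw [eval_subst]
    simp only [eval]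
    congr 1
    funext i x
    cases x <;> rfl

/-! ### The observational logical relation -/

/-- The context `x y : o`. -/
abbrev twoVars : List Ty := [Ty.o, Ty.o]

/-- The outer variable of `twoVars`. -/
abbrev varX : PTm twoVars Ty.o := .var (Var.tail Var.head)

/-- The inner variable of `twoVars`. -/
abbrev varY : PTm twoVars Ty.o := .var Var.head

theorem not_beta_varX_varY : ¬ Beta varX varY := fun h =>
  Bool.noConfusion (h.eval_eq (((Env.nil FTS).cons (k := Ty.o) true).cons (k := Ty.o) false))

/-- The binary logical relation on terms over `x y : o` that relates two terms of type `o` if both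
are beta-convertible to `x` or both to `y`. -/
def Obs : (j : Ty) → PTm twoVars j → PTm twoVars j → Prop
  | .o, a, b => (Beta a varX ∧ Beta b varX) ∨ (Beta a varY ∧ Beta b varY)
  | .arr i j, a, b => ∀ c d : PTm twoVars i, Obs i c d → Obs j (.app a c) (.app b d)

theorem Obs.symm {j : Ty} {a b : PTm twoVars j} (h : Obs j a b) : Obs j b a := by
  induction j with
  | o => exact h.imp And.symm And.symm
  | arr i j ihi ihj => exact fun c d hcd => ihj (h d c (ihi hcd))

theorem Obs.trans {j : Ty} {a b c : PTm twoVars j} (h : Obs j a b) (h' : Obs j b c) :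
    Obs j a c := by
  induction j with
  | o =>
    rcases h with ⟨ha, hb⟩ | ⟨ha, hb⟩ <;> rcases h' with ⟨hb', hc⟩ | ⟨hb', hc⟩
    · exact Or.inl ⟨ha, hc⟩
    · exact absurd (hb.symm.trans hb') not_beta_varX_varY
    · exact absurd (hb'.symm.trans hb) not_beta_varX_varY
    · exact Or.inr ⟨ha, hc⟩
  | arr i j ihi ihj =>
    exact fun d e hde => ihj (h d d (ihi hde hde.symm)) (h' d e hde)

theorem Obs.beta_left {j : Ty} {a a' b : PTm twoVars j} (ha : Beta a a') (h : Obs j a' b) :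
    Obs j a b := by
  induction j with
  | o => exact h.imp (fun h => ⟨ha.trans h.1, h.2⟩) (fun h => ⟨ha.trans h.1, h.2⟩)
  | arr i j _ ihj => exact fun c d hcd => ihj (ha.app (.refl c)) (h c d hcd)

theorem Obs.beta {j : Ty} {a a' b b' : PTm twoVars j} (ha : Beta a a') (hb : Beta b b')
    (h : Obs j a' b') : Obs j a b :=
  .beta_left ha (.symm (.beta_left hb h.symm))

/-- Pointwise `Obs` for substitutions. -/
def ObsSub {w : List Ty} (σ τ : Sub (fun _ => Empty) w twoVars) : Prop :=
  ∀ (i : Ty) (x : Var w i), Obs i (σ i x) (τ i x)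

theorem ObsSub.cons {w : List Ty} {k : Ty} {σ τ : Sub (fun _ => Empty) w twoVars}
    (h : ObsSub σ τ) {a b : PTm twoVars k} (hab : Obs k a b) :
    ObsSub (σ.cons a) (τ.cons b) := by
  intro i x
  cases x with
  | head => exact hab
  | tail x => exact h _ x

theorem ObsSub.refl_right {w : List Ty} {σ τ : Sub (fun _ => Empty) w twoVars}
    (h : ObsSub σ τ) : ObsSub τ τ :=
  fun i x => (h i x).symm.trans (h i x)

/-- The fundamental lemma of logical relations for `Obs`. -/
theorem Obs.subst {w : List Ty} {j : Ty} (t : PTm w j) {σ τ : Sub (fun _ => Empty) w twoVars}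
    (h : ObsSub σ τ) : Obs j (t.subst σ) (t.subst τ) := by
  induction t with
  | var x => exact h _ x
  | cst c => exact c.elim
  | app t s iht ihs => exact iht h _ _ (ihs h)
  | lam t ih =>
    exact fun c d hcd =>
      .beta (Beta.app_lam_subst t σ c) (Beta.app_lam_subst t τ d) (ih (h.cons hcd))

theorem Obs.refl {j : Ty} (a : PTm twoVars j) : Obs j a a := by
  have h : ObsSub (fun _ x => Tm.var x : Sub (fun _ => Empty) twoVars twoVars)
      (fun _ x => Tm.var x) := by
    rintro _ (_ | _ | x)
    · exact Or.inr ⟨.refl _, .refl _⟩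
    · exact Or.inl ⟨.refl _, .refl _⟩
    · cases x
  simpa only [Tm.subst_var] using Obs.subst a h

theorem beta_varX_or_varY (a : PTm twoVars Ty.o) : Beta a varX ∨ Beta a varY :=
  (Obs.refl a).imp And.left And.left

/-- Unrelated terms of function type are separated by a single argument. -/
theorem Obs.exists_not_app {i j : Ty} {a b : PTm twoVars (Ty.arr i j)}
    (h : ¬ Obs (Ty.arr i j) a b) : ∃ c, ¬ Obs j (.app a c) (.app b c) := by
  by_contra! h'
  exact h fun c d hcd => (h' c).trans (Obs.refl b c d hcd)

/-! ### The greatest consistent theory -/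

/-- The theory that equates two terms if they send related substitutions to related terms. -/
def obsTheory : LambdaTheory where
  rel {_ j} t s := ∀ σ τ, ObsSub σ τ → Obs j (t.subst σ) (s.subst τ)
  refl t _ _ h := Obs.subst t h
  symm hts σ τ h := (hts τ σ fun i x => (h i x).symm).symm
  trans hts hsr σ τ h := (hts σ τ h).trans (hsr τ τ h.refl_right)
  app ht hs σ τ h := ht σ τ h _ _ (hs σ τ h)
  lam {_ _ _ t s} hts σ τ h c d hcd :=
    .beta (Beta.app_lam_subst t σ c) (Beta.app_lam_subst s τ d) (hts _ _ (h.cons hcd))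
  beta t s σ τ h := by
    rw [Tm.subst_subst, Sub.single_comp]
    exact .beta_left (Beta.app_lam_subst t σ _) (Obs.subst t (h.cons (Obs.subst s h)))
  eta t σ τ h c d hcd := by
    refine .beta_left (Beta.app_lam_subst _ σ c) ?_
    simp only [Tm.subst, Tm.subst_weaken]
    exact Obs.subst t h c d hcd
  subst {_ _ _ t s} σ hts ρ ρ' h := by
    rw [Tm.subst_subst, Tm.subst_subst]
    exact hts _ _ fun i x => Obs.subst (σ i x) h

theorem beta_app_K {w : List Ty} (i : Ty) (σ : Sub (fun _ => Empty) [] w) (a b : PTm w i) :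
    Beta (.app (.app ((K i).subst σ) a) b) a :=
  .trans (.app (Beta.app_lam_subst _ σ a) (.refl b)) (Beta.app_lam_subst _ _ b)

theorem beta_app_O {w : List Ty} (i : Ty) (σ : Sub (fun _ => Empty) [] w) (a b : PTm w i) :
    Beta (.app (.app ((O i).subst σ) a) b) b :=
  .trans (.app (Beta.app_lam_subst _ σ a) (.refl b)) (Beta.app_lam_subst _ _ b)

theorem not_obs_varX_varY : ¬ Obs Ty.o varX varY := by
  rintro (⟨_, h⟩ | ⟨h, _⟩)
  · exact not_beta_varX_varY h.symm
  · exact not_beta_varX_varY h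

theorem obsTheory_not_rel_K_O : ¬ obsTheory.rel (K Ty.o) (O Ty.o) := by
  intro h
  let σ : Sub (fun _ => Empty) [] twoVars := fun _ x => nomatch x
  have h' := h σ σ (fun _ x => nomatch x) varX varX (Obs.refl _) varY varY (Obs.refl _)
  exact not_obs_varX_varY
    (.beta (beta_app_K _ σ varX varY).symm (beta_app_O _ σ varX varY).symm h')

theorem LambdaTheory.not_consistent_of_rel {T : LambdaTheory} (h : T.rel varX varY) :
    ¬ T.Consistent := by
  rintro ⟨w, j, t, s, hts⟩
  refine hts ?_
  clear hts
  induction j generalizing w with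
  | o =>
    let ν : Sub (fun _ => Empty) [] w := fun _ x => nomatch x
    exact T.subst ((ν.cons t).cons s) h
  | arr i j _ ih => exact T.trans (T.symm (T.eta t)) (T.trans (T.lam (ih _ _ _)) (T.eta s))

theorem LambdaTheory.Consistent.obs {T : LambdaTheory} (hT : T.Consistent) {j : Ty}
    {a b : PTm twoVars j} (h : T.rel a b) : Obs j a b := by
  induction j with
  | o =>
    rcases beta_varX_or_varY a with ha | ha <;> rcases beta_varX_or_varY b with hb | hb
    · exact Or.inl ⟨ha, hb⟩
    · exact absurd hT (not_consistent_of_rel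
        (T.trans (T.symm (ha.rel T)) (T.trans h (hb.rel T))))
    · exact absurd hT (not_consistent_of_rel
        (T.trans (T.symm (hb.rel T)) (T.trans (T.symm h) (ha.rel T))))
    · exact Or.inr ⟨ha, hb⟩
  | arr i j _ ih =>
    by_contra hab
    obtain ⟨c, hc⟩ := Obs.exists_not_app hab
    exact hc (ih (T.app h (T.refl c)))

theorem LambdaTheory.Consistent.le_obsTheory {T : LambdaTheory} (hT : T.Consistent) :
    T ≤ obsTheory :=
  fun _ _ t _ hts _ τ h => (Obs.subst t h).trans (hT.obs (T.subst τ hts))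

theorem obsTheory_consistent : obsTheory.Consistent :=
  ⟨_, _, _, _, obsTheory_not_rel_K_O⟩

theorem maximal_consistent_obsTheory : Maximal LambdaTheory.Consistent obsTheory :=
  ⟨obsTheory_consistent, fun _ hT _ => hT.le_obsTheory⟩

theorem eq_obsTheory_of_maximal {T : LambdaTheory} (hT : Maximal LambdaTheory.Consistent T) :
    T = obsTheory := by
  have hle : T ≤ obsTheory := hT.1.le_obsTheory
  have hge : obsTheory ≤ T := hT.2 obsTheory_consistent hle
  apply LambdaTheory.ext
  funext w j t s
  exact propext ⟨hle w j t s, hge w j t s⟩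

/-! ### Soundness and non-expansiveness of the interpretation -/

namespace ApplicativeLambdaAlgebra

variable {𝒜 : ApplicativeLambdaAlgebra.{u}}

theorem edist_le_envDist {w : List Ty} (ρ ρ' : Env 𝒜.carrier w) {i : Ty} (x : Var w i) :
    edist (ρ i x) (ρ' i x) ≤ 𝒜.envDist ρ ρ' :=
  le_iSup₂ (f := fun i (x : Var w i) => edist (ρ i x) (ρ' i x)) i x

theorem envDist_self {w : List Ty} (ρ : Env 𝒜.carrier w) : 𝒜.envDist ρ ρ = 0 := by
  simp [envDist]

theorem edist_applyEnv_le (w : List Ty) {j : Ty} (f : 𝒜.carrier (arrs w j))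
    (ρ ρ' : Env 𝒜.carrier w) :
    edist (𝒜.applyEnv w f ρ) (𝒜.applyEnv w f ρ') ≤ 𝒜.envDist ρ ρ' := by
  induction w generalizing j with
  | nil => exact (edist_self f).trans_le zero_le
  | cons k w ih =>
    refine (𝒜.app_nonexpansive _ _ _ _).trans (max_le ?_ (edist_le_envDist ρ ρ' Var.head))
    exact (ih f _ _).trans (iSup₂_le fun i x => edist_le_envDist ρ ρ' x.tail)

theorem edist_interp_le {w : List Ty} {j : Ty} (t : Tm 𝒜.carrier w j)
    (ρ ρ' : Env 𝒜.carrier w) :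
    edist (𝒜.interp t ρ) (𝒜.interp t ρ') ≤ 𝒜.envDist ρ ρ' := by
  induction t with
  | var x => exact edist_le_envDist ρ ρ' x
  | cst a => simp [interp]
  | app t s iht ihs => exact (𝒜.app_nonexpansive _ _ _ _).trans (max_le (iht _ _) (ihs _ _))
  | lam t _ => exact edist_applyEnv_le _ _ _ _

theorem edist_le_Xi {w : List Ty} {j : Ty} (f g : Env 𝒜.carrier w → 𝒜.carrier j)
    (ρ : Env 𝒜.carrier w) : edist (f ρ) (g ρ) ≤ 𝒜.Xi f g :=
  le_sInf fun δ hδ => (hδ ρ ρ).trans_eq (by rw [envDist_self, max_eq_left zero_le])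

theorem Xi_le {w : List Ty} {j : Ty} {f g : Env 𝒜.carrier w → 𝒜.carrier j} {δ : ℝ≥0∞}
    (h : ∀ ρ ρ', edist (f ρ) (g ρ') ≤ max δ (𝒜.envDist ρ ρ')) : 𝒜.Xi f g ≤ δ :=
  sInf_le h

theorem Xi_congr {w : List Ty} {j : Ty} {f f' g g' : Env 𝒜.carrier w → 𝒜.carrier j}
    (hf : ∀ ρ, edist (f ρ) (f' ρ) = 0) (hg : ∀ ρ, edist (g ρ) (g' ρ) = 0) :
    𝒜.Xi f g = 𝒜.Xi f' g' := by
  simp only [Xi, edist_congr (hf _) (hg _)]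

theorem Xi_comm {w : List Ty} {j : Ty} (f g : Env 𝒜.carrier w → 𝒜.carrier j) :
    𝒜.Xi f g = 𝒜.Xi g f := by
  have h : ∀ f g : Env 𝒜.carrier w → 𝒜.carrier j, 𝒜.Xi f g ≤ 𝒜.Xi g f := by
    refine fun f g => le_sInf fun δ hδ => Xi_le fun ρ ρ' => ?_
    rw [edist_comm]
    refine (hδ ρ' ρ).trans_eq ?_
    simp only [envDist, edist_comm]
  exact le_antisymm (h f g) (h g f)

theorem Xi_app_le {w : List Ty} {i j : Ty} (a b : Tm 𝒜.carrier w (Ty.arr i j))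
    (c : Tm 𝒜.carrier w i) :
    𝒜.Xi (𝒜.interp (.app a c)) (𝒜.interp (.app b c)) ≤ 𝒜.Xi (𝒜.interp a) (𝒜.interp b) :=
  le_sInf fun _ hδ => Xi_le fun ρ ρ' =>
    (𝒜.app_nonexpansive _ _ _ _).trans
      (max_le (hδ ρ ρ') ((edist_interp_le c ρ ρ').trans (le_max_right _ _)))

theorem IsLambdaAlgebra.edist_interp_subst (h𝒜 : 𝒜.IsLambdaAlgebra) {w w' : List Ty} {j : Ty}
    (t : Tm 𝒜.carrier w j) (σ : Sub 𝒜.carrier w w') (ρ : Env 𝒜.carrier w') :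
    edist (𝒜.interp (t.subst σ) ρ) (𝒜.interp t (fun k x => 𝒜.interp (σ k x) ρ)) = 0 := by
  induction t with
  | var x => exact edist_self _
  | cst a => exact edist_self _
  | app t s iht ihs =>
    exact nonpos_iff_eq_zero.mp
      ((𝒜.app_nonexpansive _ _ _ _).trans (max_le (iht σ).le (ihs σ).le))
  | lam t _ => exact h𝒜.natural t σ ρ

theorem IsLambdaAlgebra.edist_interp_lam (h𝒜 : 𝒜.IsLambdaAlgebra) {w : List Ty} {i j : Ty}
    {t s : Tm 𝒜.carrier (i :: w) j} (h : ∀ ρ, edist (𝒜.interp t ρ) (𝒜.interp s ρ) = 0)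
    (ρ : Env 𝒜.carrier w) :
    edist (𝒜.interp (.lam t) ρ) (𝒜.interp (.lam s) ρ) = 0 := by
  refine nonpos_iff_eq_zero.mp ((edist_le_Xi _ _ ρ).trans ((h𝒜.curry_nonexpansive t s).trans ?_))
  rw [Xi_congr h fun _ => edist_self _]
  exact Xi_le fun ρ ρ' => (edist_interp_le s ρ ρ').trans (le_max_right _ _)

theorem IsLambdaAlgebra.edist_pureInterp_subst (h𝒜 : 𝒜.IsLambdaAlgebra) {w w' : List Ty}
    {j : Ty} (t : PTm w j) (σ : Sub (fun _ => Empty) w w') (ρ : Env 𝒜.carrier w') :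
    edist (𝒜.pureInterp (t.subst σ) ρ)
      (𝒜.pureInterp t (fun k x => 𝒜.pureInterp (σ k x) ρ)) = 0 := by
  simp only [pureInterp, Tm.mapCst_subst]
  exact h𝒜.edist_interp_subst _ _ ρ

end ApplicativeLambdaAlgebra

open ApplicativeLambdaAlgebra

/-- Beta-conversion is sound in algebras that need not be extensional. -/
theorem Beta.edist_pureInterp {𝒜 : ApplicativeLambdaAlgebra.{u}} (h𝒜 : 𝒜.IsLambdaAlgebra)
    {w : List Ty} {j : Ty} {t s : PTm w j} (h : Beta t s) (ρ : Env 𝒜.carrier w) :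
    edist (𝒜.pureInterp t ρ) (𝒜.pureInterp s ρ) = 0 := by
  induction h with
  | refl t => exact edist_self _
  | symm _ ih =>
    rw [edist_comm]
    exact ih ρ
  | trans _ _ ih ih' =>
    rw [edist_congr (ih ρ) (edist_self _)]
    exact ih' ρ
  | app _ _ ih ih' =>
    exact nonpos_iff_eq_zero.mp
      ((𝒜.app_nonexpansive _ _ _ _).trans (max_le (ih ρ).le (ih' ρ).le))
  | lam _ ih => exact h𝒜.edist_interp_lam ih ρ
  | beta t s =>
    refine (edist_congr (h𝒜.retraction _ ρ _) (h𝒜.edist_pureInterp_subst t _ ρ)).trans ?_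
    have h : ρ.cons (𝒜.pureInterp s ρ) = fun k x => 𝒜.pureInterp (Sub.single s k x) ρ := by
      funext k x
      cases x <;> rfl
    exact h ▸ edist_self (𝒜.pureInterp t (ρ.cons (𝒜.pureInterp s ρ)))

/-! ### Distances in quantitative lambda-algebras -/

namespace ApplicativeLambdaAlgebra

variable {𝒜 : ApplicativeLambdaAlgebra.{u}}

theorem IsLambdaAlgebra.edist_le_termDist (h𝒜 : 𝒜.IsLambdaAlgebra) {i : Ty}
    (a b : 𝒜.carrier i) : edist a b ≤ 𝒜.termDist (K i) (O i) := by
  have key : ∀ x : Var [i, i] i,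
      edist (𝒜.app (𝒜.app (𝒜.pureInterp (.lam (.lam (.var x))) (Env.nil _)) a) b)
        ((((Env.nil 𝒜.carrier).cons a).cons b) i x) = 0 := by
    intro x
    have h := nonpos_iff_eq_zero.mp ((𝒜.app_nonexpansive _ _ b b).trans
      (max_le (h𝒜.retraction (.lam (.var x)) (Env.nil _) a).le (edist_self b).le))
    exact (edist_congr h (edist_self _)).trans (h𝒜.retraction _ _ b)
  refine (edist_congr (key (Var.tail Var.head)) (key Var.head)).symm.trans_le ?_
  refine (𝒜.app_nonexpansive _ _ _ _).trans (max_le ?_ (by simp))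
  exact (𝒜.app_nonexpansive _ _ _ _).trans (max_le le_rfl (by simp))

theorem IsLambdaAlgebra.edist_lam_lam_le (h𝒜 : 𝒜.IsLambdaAlgebra) {i j k : Ty}
    (t s : PTm [i, j] k) :
    𝒜.termDist (.lam (.lam t)) (.lam (.lam s)) ≤ 𝒜.Xi (𝒜.pureInterp t) (𝒜.pureInterp s) :=
  (edist_le_Xi _ _ (Env.nil _)).trans
    ((h𝒜.curry_nonexpansive _ _).trans (h𝒜.curry_nonexpansive _ _))

theorem IsLambdaAlgebra.termDist_K_O_le_Xi_var (h𝒜 : 𝒜.IsLambdaAlgebra) :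
    𝒜.termDist (K Ty.o) (O Ty.o) ≤ 𝒜.Xi (𝒜.pureInterp varX) (𝒜.pureInterp varY) :=
  h𝒜.edist_lam_lam_le _ _

/-- Terms over `x y : o` that are not observationally related denote functions whose distance is at
least that of `K` and `O`. -/
theorem IsLambdaAlgebra.termDist_K_O_le_Xi (h𝒜 : 𝒜.IsLambdaAlgebra) {j : Ty}
    {a b : PTm twoVars j} (h : ¬ Obs j a b) :
    𝒜.termDist (K Ty.o) (O Ty.o) ≤ 𝒜.Xi (𝒜.pureInterp a) (𝒜.pureInterp b) := by
  induction j with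
  | o =>
    rcases beta_varX_or_varY a with ha | ha <;> rcases beta_varX_or_varY b with hb | hb
    · exact absurd (Or.inl ⟨ha, hb⟩) h
    · rw [Xi_congr (ha.edist_pureInterp h𝒜) (hb.edist_pureInterp h𝒜)]
      exact h𝒜.termDist_K_O_le_Xi_var
    · rw [Xi_congr (ha.edist_pureInterp h𝒜) (hb.edist_pureInterp h𝒜), Xi_comm]
      exact h𝒜.termDist_K_O_le_Xi_var
    · exact absurd (Or.inr ⟨ha, hb⟩) h
  | arr i j _ ih =>
    obtain ⟨c, hc⟩ := Obs.exists_not_app h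
    exact (ih hc).trans (Xi_app_le _ _ _)

theorem IsLambdaAlgebra.termDist_K_O_le (h𝒜 : 𝒜.IsLambdaAlgebra) {j : Ty} {t s : PTm [] j}
    (h : ¬ obsTheory.rel t s) : 𝒜.termDist (K Ty.o) (O Ty.o) ≤ 𝒜.termDist t s := by
  have hσ : ∃ σ : Sub (fun _ => Empty) [] twoVars, ¬ Obs j (t.subst σ) (s.subst σ) := by
    by_contra! h'
    refine h fun σ τ _ => ?_
    obtain rfl : σ = τ := funext₂ fun _ x => nomatch x
    exact h' σ
  obtain ⟨σ, hσ⟩ := hσ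
  refine (h𝒜.termDist_K_O_le_Xi hσ).trans ?_
  rw [Xi_congr (h𝒜.edist_pureInterp_subst t σ) (h𝒜.edist_pureInterp_subst s σ)]
  have hnil : ∀ ρ : Env 𝒜.carrier [], ρ = Env.nil _ := fun ρ => funext₂ fun _ x => nomatch x
  exact Xi_le fun ρ ρ' => by
    rw [hnil fun k x => 𝒜.pureInterp (σ k x) ρ, hnil fun k x => 𝒜.pureInterp (σ k x) ρ']
    exact le_max_left _ _

theorem IsExtensionalLambdaAlgebra.edist_le_of_forall (h𝒜 : 𝒜.IsExtensionalLambdaAlgebra)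
    {i j : Ty} {δ : ℝ≥0∞} (hδ : ∀ a b : 𝒜.carrier j, edist a b ≤ δ)
    (a b : 𝒜.carrier (Ty.arr i j)) : edist a b ≤ δ := by
  have h := fun c : 𝒜.carrier (Ty.arr i j) => h𝒜.section_eq (.cst c) (Env.nil _)
  exact (edist_congr (h a) (h b)).symm.trans_le <|
    (edist_le_Xi _ _ (Env.nil _)).trans ((h𝒜.curry_nonexpansive _ _).trans
    (Xi_le fun _ _ => (hδ _ _).trans (le_max_left _ _)))

theorem IsExtensionalLambdaAlgebra.edist_le_termDist_o (h𝒜 : 𝒜.IsExtensionalLambdaAlgebra)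
    {i : Ty} (a b : 𝒜.carrier i) : edist a b ≤ 𝒜.termDist (K Ty.o) (O Ty.o) := by
  induction i with
  | o => exact h𝒜.edist_le_termDist a b
  | arr i j _ ih => exact h𝒜.edist_le_of_forall ih a b

theorem IsExtensionalLambdaAlgebra.termDist_eq (h𝒜 : 𝒜.IsExtensionalLambdaAlgebra) {j : Ty}
    {t s : PTm [] j} (h : ¬ obsTheory.rel t s) :
    𝒜.termDist t s = 𝒜.termDist (K Ty.o) (O Ty.o) :=
  le_antisymm (h𝒜.edist_le_termDist_o _ _) (h𝒜.termDist_K_O_le h)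

theorem IsLambdaAlgebra.termDist_K_O_le_edist (h𝒜 : 𝒜.IsLambdaAlgebra)
    (hF : 𝒜.IsFullTypeStructure) {i : Ty} {a b : 𝒜.carrier i} (hab : a ≠ b) :
    𝒜.termDist (K Ty.o) (O Ty.o) ≤ edist a b := by
  obtain ⟨e, he⟩ := hF
  induction i with
  | o =>
    -- `a` and `b` are the only points of the base type, so its diameter is their distance.
    have hcases : ∀ c : 𝒜.carrier Ty.o, c = a ∨ c = b := by
      intro c
      have key : ∀ x y z : Bool, x ≠ y → z = x ∨ z = y := by decide
      exact (key _ _ (e Ty.o c) ((e Ty.o).injective.ne hab)).imp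
        (fun h => (e Ty.o).injective h) (fun h => (e Ty.o).injective h)
    have hdiam : ∀ c d : 𝒜.carrier Ty.o, edist c d ≤ edist a b := by
      intro c d
      rcases hcases c with rfl | rfl <;> rcases hcases d with rfl | rfl <;>
        simp [edist_comm]
    exact h𝒜.termDist_K_O_le_Xi_var.trans
      (Xi_le fun _ _ => (hdiam _ _).trans (le_max_left _ _))
  | arr i j _ ih =>
    obtain ⟨z, hz⟩ := Function.ne_iff.mp ((e (Ty.arr i j)).injective.ne hab)
    have hne : 𝒜.app a ((e i).symm z) ≠ 𝒜.app b ((e i).symm z) := by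
      intro h
      have h' := congrArg (e j) h
      rw [he, he, Equiv.apply_symm_apply] at h'
      exact hz h'
    exact (ih hne).trans ((𝒜.app_nonexpansive _ _ _ _).trans (max_le le_rfl (by simp)))

end ApplicativeLambdaAlgebra

end QLam

theorem mainTheorem5 :
    -- there is exactly one maximal consistent theory
    (∃! T : LambdaTheory, Maximal LambdaTheory.Consistent T) ∧
    ∀ T : LambdaTheory, Maximal LambdaTheory.Consistent T →
      ¬ T.rel (K Ty.o) (O Ty.o) ∧
      ∀ 𝒜 : ApplicativeLambdaAlgebra.{u},
        -- what holds in all quantitative lambda-algebras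
        (𝒜.IsLambdaAlgebra →
          (∀ (i : Ty) (a b : 𝒜.carrier i), edist a b ≤ 𝒜.termDist (K i) (O i)) ∧
          (∀ (i : Ty) (t s : PTm [] i), ¬ T.rel t s →
            𝒜.termDist (K Ty.o) (O Ty.o) ≤ 𝒜.termDist t s)) ∧
        -- what holds in the extensional ones
        (𝒜.IsExtensionalLambdaAlgebra →
          (∀ (i : Ty) (t s : PTm [] i), ¬ T.rel t s →
            𝒜.termDist t s = 𝒜.termDist (K Ty.o) (O Ty.o)) ∧
          (∀ (i : Ty) (a b : 𝒜.carrier i), edist a b ≤ 𝒜.termDist (K Ty.o) (O Ty.o)) ∧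
          (𝒜.Satisfies T → ∀ (i : Ty) (t s : PTm [] i),
            (T.rel t s ∧ 𝒜.termDist t s = 0) ∨
            (¬ T.rel t s ∧ 𝒜.termDist t s = 𝒜.termDist (K Ty.o) (O Ty.o))) ∧
          (𝒜.IsFullTypeStructure → ∀ (i : Ty) (a b : 𝒜.carrier i), a ≠ b →
            edist a b = 𝒜.termDist (K Ty.o) (O Ty.o))) := by
  refine ⟨⟨obsTheory, maximal_consistent_obsTheory, fun T hT => eq_obsTheory_of_maximal hT⟩, ?_⟩
  intro T hT
  obtain rfl := eq_obsTheory_of_maximal hT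
  refine ⟨obsTheory_not_rel_K_O, fun 𝒜 => ⟨fun h𝒜 => ⟨?_, ?_⟩, fun h𝒜 => ⟨?_, ?_, ?_, ?_⟩⟩⟩
  · exact fun i a b => h𝒜.edist_le_termDist a b
  · exact fun i t s h => h𝒜.termDist_K_O_le h
  · exact fun i t s h => h𝒜.termDist_eq h
  · exact fun i a b => h𝒜.edist_le_termDist_o a b
  · intro hsat i t s
    by_cases h : obsTheory.rel t s
    · exact Or.inl ⟨h, hsat _ _ t s h (Env.nil _)⟩
    · exact Or.inr ⟨h, h𝒜.termDist_eq h⟩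
  · exact fun hF i a b hab =>
      le_antisymm (h𝒜.edist_le_termDist_o a b) (h𝒜.termDist_K_O_le_edist hF hab)
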